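/- **Theorem 2.18 (Extended sandwich theorem).** Let $X$ and $Y$ be real Banach spaces with dual spaces $X^*$, $Y^*$, and let $T\colon X\to Y$ be a bounded linear operator with adjoint $T^*\colon Y^*\to X^*$, $\langle T^*y^*,x\rangle=\langle y^*,Tx\rangle$. For a function $h$ with values in $(-\infty,+\infty]$ let $\operatorname{dom}h$ be the set of points where $h$ is finite, and let $\operatorname{cont}h$ be the set of points of $\operatorname{dom}h$ at which $h$ is continuous; $h$ is called proper if $\operatorname{dom}h\neq\varnothing$, and convex if $h(\lambda u+(1-\lambda)v)\le\lambda h(u)+(1-\lambda)h(v)$ for all $u,v\in\operatorname{dom}h$ and $\lambda\in[0,1]$. For a proper function $g\colon Y\to(-\infty,+\infty]$ and $y\in\operatorname{dom} g$ let $\partial g(y)=\{z^*\in Y^* : \langle z^*,v-y\rangle\le g(v)-g(y)\text{ for all }v\in Y\}$, and let $\partial g(y)=\varnothing$ for $y\notin\operatorname{dom}g$. Let $f\colon X\to(-\infty,+\infty]$ and $g\colon Y\to(-\infty,+\infty]$ be proper convex functions such that either $$\bigcup_{\lambda>0}\lambda\,[\operatorname{dom}g-T\operatorname{dom}f]=Y\quad\text{and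 both } f \text{ and } g \text{ are lower semicontinuous},$$ or $$\operatorname{cont}g\cap T\operatorname{dom}f\neq\varnothing .$$ Assume that $f(x)\ge -g(Tx)$ for all $x\in X$. Then there are $y^*\in Y^*$ and $r\in\mathbb R$ such that the affine function $\alpha\colon X\to\mathbb R$, $\alpha(x)=\langle T^*y^*,x\rangle+r$, satisfies $$f(x)\ge\alpha(x)\ge -g(Tx)\quad\text{for all }x\in X,$$ and such that, moreover, $-y^*\in\partial g(T\bar x)$ for every $\bar x\in X$ with $f(\bar x)=-g(T\bar x)$. -/

import Mathlib

namespace ExtConvex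

/-- The domain `f⁻¹(ℝ)` of an extended-real-valued function. -/
def dom {X : Type*} (f : X → EReal) : Set X :=
  f ⁻¹' Set.range ((↑) : ℝ → EReal)

/-- `f` takes its values in `]-∞, +∞]` and its domain is nonempty. -/
def IsProper {X : Type*} (f : X → EReal) : Prop :=
  (∀ x, f x ≠ ⊥) ∧ (dom f).Nonempty

/-- Convexity of a function with values in `]-∞, +∞]`. The points `x`, `y` range over the domain,
so the right-hand side is a sum of finite terms. -/
def IsConvex {X : Type*} [AddCommGroup X] [Module ℝ X] (f : X → EReal) : Prop :=
  ∀ x ∈ dom f, ∀ y ∈ dom f, ∀ t : ℝ, 0 ≤ t → t ≤ 1 →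
    f (t • x + (1 - t) • y) ≤ (t : EReal) * f x + ((1 - t : ℝ) : EReal) * f y

/-- `cont f`: the points at which `f` is finite and continuous. (Finiteness has to be required
explicitly, as `f` is continuous, as a map into `EReal`, wherever it is locally equal to `⊤`.) -/
def cont {X : Type*} [TopologicalSpace X] (f : X → EReal) : Set X :=
  {x | x ∈ dom f ∧ ContinuousAt f x}

/-- The subdifferential `∂f(x)` of a proper function. If `f x = ⊤`, the right-hand side `f y - f x`
is `⊥` for all `y`, and the set is empty, as it has to be for a proper `f`. -/
def subdifferential {X : Type*} [NormedAddCommGroup X] [NormedSpace ℝ X]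
    (f : X → EReal) (x : X) : Set (StrongDual ℝ X) :=
  {φ | ∀ y : X, ((φ (y - x) : ℝ) : EReal) ≤ f y - f x}

/-- The Banach space adjoint `T* : Y* → X*`, `⟨T* φ, x⟩ = ⟨φ, T x⟩`. -/
def adjoint {X Y : Type*} [NormedAddCommGroup X] [NormedSpace ℝ X]
    [NormedAddCommGroup Y] [NormedSpace ℝ Y] (T : X →L[ℝ] Y) (φ : StrongDual ℝ Y) :
    StrongDual ℝ X :=
  φ.comp T

end ExtConvex

open scoped Pointwise

open scoped Pointwise

namespace ExtConvex

/-! ### Real majorants of extended-valued convex functions. -/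

section Functions

variable {X : Type*} {f : X → EReal}

/-! Consider the pairs `(v - T x, s)` with `f x + g v ≤ s`. They form a convex set, nonnegative over
the origin because `-g ∘ T ≤ f`. Once it contains a half-cylinder around the vertical axis,
Hahn-Banach (`exists_dual_le_of_convex`) gives `ψ (v - T x) ≤ f x + g v`. Hence `ψ - g` lies below
some real `r`, and `f + ψ ∘ T` above it; take `-ψ` and `r`. The half-cylinder is immediate when `g`
is continuous at a point of `T '' dom f`. Otherwise Baire makes the closure of a difference of
sublevel sets a neighbourhood of `0`, and `half_smul_mem_sub_image` removes the closure by a dyadic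
series, as in the open mapping theorem. -/

lemma mem_dom_of_le (hf : ∀ x, f x ≠ ⊥) {x : X} {a : ℝ} (h : f x ≤ a) : x ∈ dom f :=
  ⟨(f x).toReal, EReal.coe_toReal (ne_top_of_le_ne_top (EReal.coe_ne_top a) h) (hf x)⟩

lemma IsConvex.combo_le [AddCommGroup X] [Module ℝ X] (hc : IsConvex f) (hf : ∀ x, f x ≠ ⊥)
    {x y : X} {a b s t : ℝ} (hx : f x ≤ a) (hy : f y ≤ b) (hs : 0 ≤ s) (ht : 0 ≤ t)
    (hst : s + t = 1) : f (s • x + t • y) ≤ ((s * a + t * b : ℝ) : EReal) := by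
  have hxd := mem_dom_of_le hf hx
  have hyd := mem_dom_of_le hf hy
  obtain rfl : t = 1 - s := by linarith
  refine (hc x hxd y hyd s hs (by linarith)).trans ?_
  obtain ⟨u, hu⟩ := hxd
  obtain ⟨w, hw⟩ := hyd
  rw [← hu] at hx ⊢
  rw [← hw] at hy ⊢
  have hx' : u ≤ a := EReal.coe_le_coe_iff.1 hx
  have hy' : w ≤ b := EReal.coe_le_coe_iff.1 hy
  norm_cast
  gcongr

lemma IsConvex.convex_sublevel [AddCommGroup X] [Module ℝ X] (hc : IsConvex f)
    (hf : ∀ x, f x ≠ ⊥) (a : ℝ) : Convex ℝ {x | f x ≤ a} := by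
  intro x hx y hy s t hs ht hst
  have h := hc.combo_le hf hx hy hs ht hst
  rwa [← add_mul, hst, one_mul] at h

end Functions

section Banach

variable {X Y : Type*} [NormedAddCommGroup X] [NormedSpace ℝ X]
  [NormedAddCommGroup Y] [NormedSpace ℝ Y]

/-! ### Dyadic series and Baire category. -/

/-- A closed convex set contains the limits of its infinite dyadic convex combinations. -/
lemma mem_of_tendsto_dyadic_combo {K : Set X} (hK : Convex ℝ K) (hcl : IsClosed K)
    {p : ℕ → X} (hp : ∀ i, p i ∈ K) {z : X}
    (hz : Filter.Tendsto (fun N => ∑ i ∈ Finset.range N, (1 / 2 : ℝ) ^ (i + 1) • p i)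
      Filter.atTop (nhds z)) : z ∈ K := by
  have key : ∀ N : ℕ, ∀ q ∈ K,
      ∑ i ∈ Finset.range N, (1 / 2 : ℝ) ^ (i + 1) • p i + (1 / 2 : ℝ) ^ N • q ∈ K := by
    intro N
    induction N with
    | zero => intro q hq; simpa using hq
    | succ N ih =>
      intro q hq
      -- Replacing the tail point `q` by its midpoint with `p N` splits off the next term.
      have hmid := hK (hp N) hq (by norm_num : (0 : ℝ) ≤ 1 / 2) (by norm_num : (0 : ℝ) ≤ 1 / 2)
        (by norm_num)
      convert ih _ hmid using 1
      rw [Finset.sum_range_succ, add_assoc, smul_add, smul_smul, smul_smul, pow_succ]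
  refine hcl.mem_of_tendsto (b := Filter.atTop) ?_ (Filter.Eventually.of_forall
    fun N => key N (p 0) (hp 0))
  have h0 : Filter.Tendsto (fun N : ℕ => (1 / 2 : ℝ) ^ N • p 0) Filter.atTop (nhds 0) := by
    simpa using (tendsto_pow_atTop_nhds_zero_of_lt_one (by norm_num : (0 : ℝ) ≤ 1 / 2)
      (by norm_num)).smul_const (p 0)
  simpa using hz.add h0

/-- If the closure of `C - T '' B` contains a ball around `0`, then `C - T '' B` contains the
ball of half its radius. -/
lemma half_smul_mem_sub_image [CompleteSpace X] (T : X →L[ℝ] Y) {B : Set X} {C : Set Y}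
    (hB : Convex ℝ B) (hBcl : IsClosed B) {R : ℝ} (hBR : ∀ x ∈ B, ‖x‖ ≤ R)
    (hC : Convex ℝ C) (hCcl : IsClosed C) {r : ℝ}
    (hball : Metric.ball 0 r ⊆ closure (C - T '' B)) {y : Y} (hy : y ∈ Metric.ball 0 r) :
    (1 / 2 : ℝ) • y ∈ C - T '' B := by
  have hr : 0 < r := Metric.nonempty_ball.1 ⟨y, hy⟩
  have happrox : ∀ z : Metric.ball (0 : Y) r, ∃ x v, x ∈ B ∧ v ∈ C ∧
      ‖(z : Y) - (v - T x)‖ < r / 2 := by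
    intro z
    obtain ⟨w, hw, hd⟩ := Metric.mem_closure_iff.1 (hball z.2) (r / 2) (by linarith)
    obtain ⟨v, hv, _, ⟨x, hx, rfl⟩, rfl⟩ := Set.mem_sub.1 hw
    exact ⟨x, v, hx, hv, by rwa [dist_eq_norm] at hd⟩
  choose ξ η hξ hη hlt using happrox
  -- An error below `r / 2`, doubled, is again in the ball, so the approximation can be iterated.
  let step : Metric.ball (0 : Y) r → Metric.ball (0 : Y) r := fun z =>
    ⟨(2 : ℝ) • ((z : Y) - (η z - T (ξ z))), by
      rw [mem_ball_zero_iff, norm_smul, Real.norm_ofNat]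
      linarith [hlt z]⟩
  let Z : ℕ → Metric.ball (0 : Y) r := fun n => step^[n] ⟨y, hy⟩
  have hZ : ∀ n, (Z (n + 1) : Y) = (2 : ℝ) • ((Z n : Y) - (η (Z n) - T (ξ (Z n)))) := by
    intro n
    simp only [Z, Function.iterate_succ_apply']
    rfl
  have hsum : ∀ N, ∑ i ∈ Finset.range N, (1 / 2 : ℝ) ^ (i + 1) • (η (Z i) - T (ξ (Z i)))
      = (1 / 2 : ℝ) • y - (1 / 2 : ℝ) ^ (N + 1) • (Z N : Y) := by
    intro N
    induction N with
    | zero => simp [Z]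
    | succ N ih =>
      rw [Finset.sum_range_succ, ih, hZ, pow_succ _ (N + 1)]
      module
  have htail : Filter.Tendsto (fun N : ℕ => (1 / 2 : ℝ) ^ (N + 1) • (Z N : Y))
      Filter.atTop (nhds 0) := by
    have hgeo : Filter.Tendsto (fun N : ℕ => (1 / 2 : ℝ) ^ (N + 1) * r)
        Filter.atTop (nhds 0) := by
      simpa using ((tendsto_pow_atTop_nhds_zero_of_lt_one (by norm_num : (0 : ℝ) ≤ 1 / 2)
        (by norm_num)).comp (Filter.tendsto_add_atTop_nat 1)).mul_const r
    refine squeeze_zero_norm (fun N => ?_) hgeo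
    rw [norm_smul, Real.norm_of_nonneg (by positivity)]
    gcongr
    exact (mem_ball_zero_iff.1 (Z N).2).le
  have hlimy : Filter.Tendsto
      (fun N => ∑ i ∈ Finset.range N, (1 / 2 : ℝ) ^ (i + 1) • (η (Z i) - T (ξ (Z i))))
      Filter.atTop (nhds ((1 / 2 : ℝ) • y)) := by
    simp_rw [hsum]
    simpa using tendsto_const_nhds.sub htail
  have hsummable : Summable fun i : ℕ => (1 / 2 : ℝ) ^ (i + 1) • ξ (Z i) := by
    refine Summable.of_norm_bounded (g := fun i : ℕ => (1 / 2 : ℝ) ^ (i + 1) * R) ?_ fun i => ?_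
    · exact ((summable_nat_add_iff 1).2 summable_geometric_two).mul_right R
    · rw [norm_smul, Real.norm_of_nonneg (by positivity)]
      gcongr
      exact hBR _ (hξ _)
  obtain ⟨x, hx⟩ := hsummable
  have hlimx := hx.tendsto_sum_nat
  -- `C` may be unbounded, so this convergence is deduced from those of the differences and of the
  -- `ξ` series.
  have hlimv : Filter.Tendsto
      (fun N => ∑ i ∈ Finset.range N, (1 / 2 : ℝ) ^ (i + 1) • η (Z i))
      Filter.atTop (nhds ((1 / 2 : ℝ) • y + T x)) := by
    refine (hlimy.add ((T.continuous.tendsto x).comp hlimx)).congr fun N => ?_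
    simp [smul_sub, Finset.sum_sub_distrib]
  exact Set.mem_sub.2 ⟨_, mem_of_tendsto_dyadic_combo hC hCcl (fun i => hη (Z i)) hlimv, _,
    ⟨x, mem_of_tendsto_dyadic_combo hB hBcl (fun i => hξ (Z i)) hlimx, rfl⟩, by abel⟩

/-- If an increasing sequence of convex sets in a Banach space has absorbing union, then the
closure of one of them is a neighbourhood of `0`. -/
lemma exists_zero_mem_interior_closure [CompleteSpace Y] {S : ℕ → Set Y} (hmono : Monotone S)
    (hconv : ∀ n, Convex ℝ (S n)) (habs : ∀ y, ∃ c : ℝ, 0 < c ∧ ∃ n, c • y ∈ S n) :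
    ∃ n, 0 ∈ interior (closure (S n)) := by
  obtain ⟨_, _, n₀, h0⟩ := habs 0
  rw [smul_zero] at h0
  let F : ℕ × ℕ → Set Y := fun p => {y | (1 / ((p.1 : ℝ) + 1)) • y ∈ closure (S p.2)}
  have hFcl : ∀ p, IsClosed (F p) := fun p =>
    isClosed_closure.preimage (continuous_const_smul _)
  have hcover : ⋃ p, F p = Set.univ := by
    refine Set.eq_univ_of_forall fun y => Set.mem_iUnion.2 ?_
    obtain ⟨c, hc, n, hn⟩ := habs y
    obtain ⟨k, hk⟩ := exists_nat_one_div_lt hc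
    -- Beyond `n₀` the sets contain `0`, so `c • y` may be shrunk to the scale `1 / (k + 1)`.
    refine ⟨(k, max n n₀), subset_closure ?_⟩
    have hpos : 0 < 1 / ((k : ℝ) + 1) := by positivity
    have h := (hconv (max n n₀)).smul_mem_of_zero_mem (hmono (le_max_right n n₀) h0)
      (hmono (le_max_left n n₀) hn)
      (t := 1 / ((k : ℝ) + 1) / c) ⟨by positivity, (div_le_one hc).2 hk.le⟩
    rwa [smul_smul, div_mul_cancel₀ _ hc.ne'] at h
  obtain ⟨⟨k, n⟩, b, hb⟩ := nonempty_interior_of_iUnion_of_closed hFcl hcover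
  have hk : (1 / ((k : ℝ) + 1)) ≠ 0 := by positivity
  have hb' : (1 / ((k : ℝ) + 1)) • b ∈ interior (closure (S n)) := by
    have := (Homeomorph.smulOfNeZero (α := Y) _ hk).preimage_interior (closure (S n))
    exact this.ge hb
  set b' := (1 / ((k : ℝ) + 1)) • b
  -- `0` lies between the interior point `b'` and a positive multiple of `-b'`.
  obtain ⟨c, hc, m, hm⟩ := habs (-b')
  refine ⟨max n m, ?_⟩
  have h1 := interior_mono (closure_mono (hmono (le_max_left n m))) hb'
  have h2 := subset_closure (hmono (le_max_right n m) hm)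
  have h3 := (hconv (max n m)).closure.combo_interior_self_mem_interior h1 h2
    (a := c / (1 + c)) (b := 1 / (1 + c)) (by positivity) (by positivity) (by field_simp; ring)
  convert h3 using 1
  rw [smul_neg, smul_neg, smul_smul _ c, one_div_mul_eq_div, add_neg_cancel]

/-! ### Separation and duality. -/

/-- Separation in `Y × ℝ`: a convex set lying above `0` over the origin and containing a
half-cylinder around the vertical axis lies above the graph of a continuous functional. -/
lemma exists_dual_le_of_convex {A : Set (Y × ℝ)} (hA : Convex ℝ A)
    (h0 : ∀ s, ((0 : Y), s) ∈ A → 0 ≤ s) {r M : ℝ} (hr : 0 < r)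
    (hball : ∀ y ∈ Metric.ball (0 : Y) r, ∀ s, M < s → (y, s) ∈ A) :
    ∃ ψ : StrongDual ℝ Y, ∀ p ∈ A, ψ p.1 ≤ p.2 := by
  have hsub : Metric.ball (0 : Y) r ×ˢ Set.Ioi M ⊆ interior A :=
    interior_maximal (fun p hp => hball p.1 hp.1 p.2 hp.2) (Metric.isOpen_ball.prod isOpen_Ioi)
  have hM : ((0 : Y), M + 1) ∈ interior A :=
    hsub ⟨Metric.mem_ball_self hr, lt_add_one M⟩
  have hnot : ((0 : Y), (0 : ℝ)) ∉ interior A := by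
    intro h
    have hev : ∀ᶠ s : ℝ in nhds 0, ((0 : Y), s) ∈ A :=
      (Continuous.prodMk_right (0 : Y)).continuousAt.eventually (mem_interior_iff_mem_nhds.1 h)
    obtain ⟨s, hs, hs0⟩ := ((hev.filter_mono nhdsWithin_le_nhds).and
      (self_mem_nhdsWithin : Set.Iio (0 : ℝ) ∈ nhdsWithin 0 (Set.Iio 0))).exists
    exact absurd (h0 s hs) (not_le.2 hs0)
  obtain ⟨L, hL⟩ := geometric_hahn_banach_open_point hA.interior isOpen_interior hnot
  rw [Prod.mk_zero_zero, map_zero] at hL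
  have hLA : ∀ p ∈ A, L p ≤ 0 := by
    intro p hp
    have hp' : p ∈ closure (interior A) := by
      rw [hA.closure_interior_eq_closure_of_nonempty_interior ⟨_, hM⟩]
      exact subset_closure hp
    exact closure_minimal (t := {q | L q ≤ 0}) (fun q hq => (hL q hq).le)
      (isClosed_le L.continuous continuous_const) hp'
  have hsplit : ∀ p : Y × ℝ, L p = L (p.1, 0) + p.2 * L (0, 1) := by
    intro p
    rw [← smul_eq_mul, ← map_smul, ← map_add]
    simp
  set c := L ((0 : Y), (1 : ℝ))
  have hMpos : 0 ≤ M + 1 := h0 _ (interior_subset hM)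
  -- The separating hyperplane is not vertical.
  have hc : c < 0 := by
    have h := hL _ hM
    rw [hsplit] at h
    simp only [Prod.mk_zero_zero, map_zero, zero_add] at h
    by_contra! hcn
    exact absurd h (not_lt.2 (mul_nonneg hMpos hcn))
  refine ⟨(-c)⁻¹ • L.comp (ContinuousLinearMap.inl ℝ Y ℝ), fun p hp => ?_⟩
  have h := hLA p hp
  rw [hsplit] at h
  simp only [smul_apply, ContinuousLinearMap.comp_apply,
    ContinuousLinearMap.inl_apply, smul_eq_mul]
  rw [inv_mul_le_iff₀ (by linarith)]
  linarith

/-- The first qualification condition: `f x` and `g v` are bounded by a constant on suitable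
representations `y = v - T x` of all `y` near `0`. -/
lemma exists_ball_le_of_absorbing [CompleteSpace X] [CompleteSpace Y] (T : X →L[ℝ] Y)
    {f : X → EReal} {g : Y → EReal} (hf : ∀ x, f x ≠ ⊥) (hfc : IsConvex f)
    (hg : ∀ y, g y ≠ ⊥) (hgc : IsConvex g)
    (habs : (⋃ c ∈ Set.Ioi (0 : ℝ), c • (dom g - T '' dom f)) = Set.univ)
    (hfl : LowerSemicontinuous f) (hgl : LowerSemicontinuous g) :
    ∃ r > 0, ∃ a b : ℝ, ∀ y ∈ Metric.ball (0 : Y) r, ∃ x v, f x ≤ a ∧ g v ≤ b ∧ v - T x = y := by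
  -- Only the `X` side is truncated by a ball: the dyadic series needs no bound in `Y`.
  let B : ℕ → Set X := fun n => {x | f x ≤ ((n : ℝ) : EReal)} ∩ Metric.closedBall 0 n
  let C : ℕ → Set Y := fun n => {v | g v ≤ ((n : ℝ) : EReal)}
  have hB : ∀ n, Convex ℝ (B n) := fun n =>
    (hfc.convex_sublevel hf n).inter (convex_closedBall 0 _)
  have hC : ∀ n, Convex ℝ (C n) := fun n => hgc.convex_sublevel hg n
  have hBm : Monotone B := fun m n hmn => by
    have hmn' : (m : ℝ) ≤ n := Nat.cast_le.2 hmn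
    exact Set.inter_subset_inter (fun x hx => le_trans hx (EReal.coe_le_coe_iff.2 hmn'))
      (Metric.closedBall_subset_closedBall hmn')
  have hCm : Monotone C := fun m n hmn x hx =>
    le_trans hx (EReal.coe_le_coe_iff.2 (Nat.cast_le.2 hmn))
  have hS : ∀ n, Convex ℝ (C n - T '' B n) := fun n =>
    (hC n).sub ((hB n).is_linear_image T.toLinearMap.isLinear)
  obtain ⟨n, hn⟩ := exists_zero_mem_interior_closure (S := fun n => C n - T '' B n)
    (fun m n hmn => Set.sub_subset_sub (hCm hmn) (Set.image_mono (hBm hmn))) hS (by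
      intro y
      have hy : y ∈ ⋃ c ∈ Set.Ioi (0 : ℝ), c • (dom g - T '' dom f) := habs ▸ Set.mem_univ y
      simp only [Set.mem_iUnion, Set.mem_Ioi] at hy
      obtain ⟨c, hc, w, hw, rfl⟩ := hy
      obtain ⟨v, ⟨b, hb⟩, _, ⟨x, ⟨a, ha⟩, rfl⟩, rfl⟩ := Set.mem_sub.1 hw
      obtain ⟨n, hn⟩ := exists_nat_ge (max (max a b) ‖x‖)
      refine ⟨c⁻¹, inv_pos.2 hc, n, ?_⟩
      simp only [inv_smul_smul₀ hc.ne']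
      refine Set.sub_mem_sub ?_ ⟨x, ⟨?_, ?_⟩, rfl⟩
      · change g v ≤ _
        rw [← hb]
        exact EReal.coe_le_coe_iff.2 (((le_max_right a b).trans (le_max_left _ _)).trans hn)
      · change f x ≤ _
        rw [← ha]
        exact EReal.coe_le_coe_iff.2 (((le_max_left a b).trans (le_max_left _ _)).trans hn)
      · exact mem_closedBall_zero_iff.2 ((le_max_right _ _).trans hn))
  obtain ⟨r, hr, hball⟩ := Metric.mem_nhds_iff.1 (mem_interior_iff_mem_nhds.1 hn)
  refine ⟨r / 2, by linarith, n, n, fun y hy => ?_⟩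
  have h := half_smul_mem_sub_image T (hB n)
    ((hfl.isClosed_preimage _).inter Metric.isClosed_closedBall)
    (fun x hx => mem_closedBall_zero_iff.1 hx.2) (hC n) (hgl.isClosed_preimage _) hball
    (y := (2 : ℝ) • y) (by
      rw [mem_ball_zero_iff] at hy ⊢
      rw [norm_smul, Real.norm_ofNat]
      linarith)
  rw [smul_smul, one_div, inv_mul_cancel₀ two_ne_zero, one_smul] at h
  obtain ⟨v, hv, _, ⟨x, hx, rfl⟩, rfl⟩ := Set.mem_sub.1 h
  exact ⟨x, v, hx.1, hv, rfl⟩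

/-- The second qualification condition gives the same bound. -/
lemma exists_ball_le_of_cont (T : X →L[ℝ] Y) {f : X → EReal} {g : Y → EReal}
    (h : (cont g ∩ T '' dom f).Nonempty) :
    ∃ r > 0, ∃ a b : ℝ, ∀ y ∈ Metric.ball (0 : Y) r, ∃ x v, f x ≤ a ∧ g v ≤ b ∧ v - T x = y := by
  obtain ⟨_, ⟨⟨b, hb⟩, hcont⟩, x, ⟨a, ha⟩, rfl⟩ := h
  have hlt : g (T x) < ((b + 1 : ℝ) : EReal) := by
    rw [← hb]
    exact EReal.coe_lt_coe_iff.2 (lt_add_one b)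
  obtain ⟨r, hr, hball⟩ := Metric.eventually_nhds_iff_ball.1 (hcont.eventually_lt_const hlt)
  refine ⟨r, hr, a, b + 1, fun y hy => ⟨x, y + T x, ha.ge, (hball _ ?_).le, by abel⟩⟩
  simpa [dist_eq_norm] using hy

/-- Fenchel duality for functions satisfying the boundedness condition near `0`. -/
lemma exists_dual_le_add (T : X →L[ℝ] Y) {f : X → EReal} {g : Y → EReal}
    (hf : ∀ x, f x ≠ ⊥) (hfc : IsConvex f) (hg : ∀ y, g y ≠ ⊥) (hgc : IsConvex g)
    (hbd : ∃ r > 0, ∃ a b : ℝ, ∀ y ∈ Metric.ball (0 : Y) r,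
      ∃ x v, f x ≤ a ∧ g v ≤ b ∧ v - T x = y)
    (hfg : ∀ x, -g (T x) ≤ f x) :
    ∃ ψ : StrongDual ℝ Y, ∀ x v, ∀ a b : ℝ, f x ≤ a → g v ≤ b → ψ (v - T x) ≤ a + b := by
  obtain ⟨r, hr, a, b, hball⟩ := hbd
  let A : Set (Y × ℝ) :=
    {p | ∃ x v, ∃ a b : ℝ, f x ≤ a ∧ g v ≤ b ∧ v - T x = p.1 ∧ a + b ≤ p.2}
  have hA : Convex ℝ A := by
    rintro p ⟨x, v, a, b, hx, hv, hp, hab⟩ q ⟨x', v', a', b', hx', hv', hq, hab'⟩ s t hs ht hst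
    refine ⟨_, _, _, _, hfc.combo_le hf hx hx' hs ht hst, hgc.combo_le hg hv hv' hs ht hst, ?_, ?_⟩
    · rw [Prod.fst_add, Prod.smul_fst, Prod.smul_fst, ← hp, ← hq, map_add, map_smul, map_smul]
      module
    · rw [Prod.snd_add, Prod.smul_snd, Prod.smul_snd, smul_eq_mul, smul_eq_mul]
      linarith [mul_le_mul_of_nonneg_left hab hs, mul_le_mul_of_nonneg_left hab' ht]
  obtain ⟨ψ, hψ⟩ := exists_dual_le_of_convex hA (M := a + b) (by
    rintro s ⟨x, v, a, b, hx, hv, hxv, hab⟩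
    rw [sub_eq_zero.1 hxv] at hv
    have h : ((-b : ℝ) : EReal) ≤ a := by
      rw [EReal.coe_neg]
      exact ((EReal.neg_le_neg_iff.2 hv).trans (hfg x)).trans hx
    linarith [EReal.coe_le_coe_iff.1 h]) hr (fun y hy s hs => by
      obtain ⟨x, v, hx, hv, hxv⟩ := hball y hy
      exact ⟨x, v, a, b, hx, hv, hxv, hs.le⟩)
  exact ⟨ψ, fun x v a b hx hv => hψ (v - T x, a + b) ⟨x, v, a, b, hx, hv, rfl, le_rfl⟩⟩

end Banach

end ExtConvex

open ExtConvex in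
theorem theorem2p18 {X Y : Type*}
    [NormedAddCommGroup X] [NormedSpace ℝ X] [CompleteSpace X]
    [NormedAddCommGroup Y] [NormedSpace ℝ Y] [CompleteSpace Y]
    (T : X →L[ℝ] Y) (f : X → EReal) (g : Y → EReal)
    (hf_proper : ExtConvex.IsProper f) (hf_convex : ExtConvex.IsConvex f)
    (hg_proper : ExtConvex.IsProper g) (hg_convex : ExtConvex.IsConvex g)
    (hCQ :
      ((⋃ c ∈ Set.Ioi (0 : ℝ), c • (ExtConvex.dom g - T '' ExtConvex.dom f)) = Set.univ ∧
        LowerSemicontinuous f ∧ LowerSemicontinuous g) ∨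
      (ExtConvex.cont g ∩ T '' ExtConvex.dom f).Nonempty)
    (hfg : ∀ x, -g (T x) ≤ f x) :
    ∃ (φ : StrongDual ℝ Y) (r : ℝ) (α : X → ℝ),
      (∀ x, α x = ExtConvex.adjoint T φ x + r) ∧
      (∀ x, (α x : EReal) ≤ f x ∧ -g (T x) ≤ (α x : EReal)) ∧
      ∀ x₀ : X, f x₀ = -g (T x₀) → -φ ∈ ExtConvex.subdifferential g (T x₀) := by
  obtain ⟨hf, x₁, a₁, ha₁⟩ := hf_proper
  obtain ⟨hg, v₁, b₁, hb₁⟩ := hg_proper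
  have hbd : ∃ r > 0, ∃ a b : ℝ, ∀ y ∈ Metric.ball (0 : Y) r,
      ∃ x v, f x ≤ a ∧ g v ≤ b ∧ v - T x = y := by
    rcases hCQ with ⟨habs, hfl, hgl⟩ | h
    · exact exists_ball_le_of_absorbing T hf hf_convex hg hg_convex habs hfl hgl
    · exact exists_ball_le_of_cont T h
  obtain ⟨ψ, hψ⟩ := exists_dual_le_add T hf hf_convex hg hg_convex hbd hfg
  obtain ⟨r, hr₁, hr₂⟩ := exists_between_of_forall_le
    (s := {t : ℝ | ∃ v, ∃ b : ℝ, g v ≤ b ∧ t = ψ v - b})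
    (t := {t : ℝ | ∃ x, ∃ a : ℝ, f x ≤ a ∧ t = a + ψ (T x)})
    ⟨_, v₁, b₁, hb₁.ge, rfl⟩ ⟨_, x₁, a₁, ha₁.ge, rfl⟩ (by
      rintro _ ⟨v, b, hv, rfl⟩ _ ⟨x, a, hx, rfl⟩
      have h := hψ x v a b hx hv
      rw [map_sub] at h
      linarith)
  have hfr : ∀ x, ((-ψ (T x) + r : ℝ) : EReal) ≤ f x := by
    intro x
    -- Testing against real `a > f x` makes the case `f x = ⊤` vacuous.
    refine EReal.le_of_forall_lt_iff_le.1 fun a ha => EReal.coe_le_coe_iff.2 ?_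
    linarith [hr₂ ⟨x, a, ha.le, rfl⟩]
  have hgr : ∀ v, ((ψ v - r : ℝ) : EReal) ≤ g v := by
    intro v
    refine EReal.le_of_forall_lt_iff_le.1 fun b hb => EReal.coe_le_coe_iff.2 ?_
    linarith [hr₁ ⟨v, b, hb.le, rfl⟩]
  refine ⟨-ψ, r, fun x => -ψ (T x) + r, fun x => rfl, fun x => ⟨hfr x, ?_⟩, fun x₀ hx₀ y => ?_⟩
  · rw [EReal.neg_le, ← EReal.coe_neg, neg_add, neg_neg, ← sub_eq_add_neg]
    exact hgr (T x)
  · have htop : g (T x₀) ≠ ⊤ := fun h => hf x₀ (by rw [hx₀, h, EReal.neg_top])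
    lift g (T x₀) to ℝ using ⟨htop, hg _⟩ with c hc
    -- Contact gives `c ≤ ψ (T x₀) - r`, so the affine minorant `ψ - r` of `g` is exact at `T x₀`.
    have h₁ := hfr x₀
    rw [hx₀, ← EReal.coe_neg, EReal.coe_le_coe_iff] at h₁
    rw [neg_neg, map_sub, EReal.le_sub_iff_add_le (by simp) (by simp), ← EReal.coe_add]
    exact (EReal.coe_le_coe_iff.2 (by linarith)).trans (hgr y)
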